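/- A deterministic one-tape Turing machine (DTM) is a tuple $M=(Q,\Sigma,\Gamma,\delta,q_0,F)$ with a finite set of states $Q$, a finite working alphabet $\Gamma$ containing a blank symbol $\flat$, an input alphabet $\Sigma\subseteq\Gamma\setminus\{\flat\}$, an initial state $q_0\in Q$, a set of final states $F\subseteq Q$, and a partial transition function $\delta:Q\times\Gamma\rightharpoonup Q\times(\Gamma\setminus\{\flat\})\times\{-1,+1\}$. It works on a bi-infinite tape that initially contains the input $w\in\Sigma^*$ on consecutive cells and blanks elsewhere, starting in state $q_0$ on the leftmost symbol of $w$ (on a blank cell if $w$ is empty). If $\delta(p,\sigma)=(q,\tau,d)$, then in state $p$ scanning $\sigma$ it writes $\tau$, enters state $q$ and moves its head by $d$; if $\delta(p,\sigma)$ is undefined it halts. The language $L(M)$ consists of the inputs on which $M$ eventually halts in a final state. The machine is weight-reducing if there is a partial order $<$ on $\Gamma$ such that $\delta(p,\sigma)=(q,\tau,d)$ always implies $\tau<\sigma$. Theorem. There is an absolute constant $C>0$ such that for every weight-reducing DTM $M=(Q,\Sigma,\Gamma,\delta,q_0,F)$, writing $\ell=\max(1,\log_2|Q|)$: 1. there is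 a nondeterministic finite automaton (with a single initial state and no $\varepsilon$-transitions) accepting $L(M)$ with at most $2^{C\cdot|\Gamma|\cdot \ell}$ states; 2. there is a (complete) deterministic finite automaton accepting $L(M)$ with at most $2^{2^{C\cdot|\Gamma|\cdot \ell}}$ states. In particular, for $|Q|\ge 2$ the automata have $2^{O(|\Gamma|\log|Q|)}$ and $2^{2^{O(|\Gamma|\log|Q|)}}$ states, respectively. -/

import Mathlib

/-- A deterministic one-tape Turing machine with state set `Q` and working alphabet `Γ`.
The input alphabet is a subset of `Γ` that does not contain the blank symbol, the transition
function is partial, every transition rewrites the scanned cell by a non-blank symbol and moves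
the head one cell to the left or to the right. -/
structure OneTapeDTM (Q Γ : Type*) where
  /-- the input alphabet -/
  input : Set Γ
  /-- the blank symbol -/
  blank : Γ
  blank_notMem_input : blank ∉ input
  /-- the partial transition function; `none` means undefined -/
  δ : Q → Γ → Option (Q × Γ × Turing.Dir)
  write_ne_blank : ∀ p σ q τ d, δ p σ = some (q, τ, d) → τ ≠ blank
  /-- the initial state -/
  start : Q
  /-- the final states -/
  final : Set Q

namespace OneTapeDTM

/-- A configuration: the current state, the contents of the bi-infinite tape (whose cells are
indexed by the integers), and the position of the head. -/
structure Config (Q Γ : Type*) where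
  state : Q
  tape : ℤ → Γ
  head : ℤ

/-- The position reached from cell `i` by moving one cell in the given direction. -/
def move (i : ℤ) : Turing.Dir → ℤ
  | Turing.Dir.left => i - 1
  | Turing.Dir.right => i + 1

variable {Q Γ : Type*}

/-- The configuration `c'` is a successor of `c`. -/
def Yields (M : OneTapeDTM Q Γ) (c c' : Config Q Γ) : Prop :=
  ∃ q τ d, M.δ c.state (c.tape c.head) = some (q, τ, d) ∧
    c' = ⟨q, Function.update c.tape c.head τ, move c.head d⟩

/-- A configuration is halting if it has no successor. -/
def Halting (M : OneTapeDTM Q Γ) (c : Config Q Γ) : Prop :=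
  ∀ c', ¬ M.Yields c c'

/-- The initial tape for `w`: the cells `0, …, |w| - 1` hold `w`, all others are blank. -/
def initTape (M : OneTapeDTM Q Γ) (w : List M.input) (i : ℤ) : Γ :=
  if h : 0 ≤ i ∧ i.toNat < w.length then (w[i.toNat]'h.2 : Γ) else M.blank

/-- The initial configuration on input `w`: the head scans the leftmost symbol of `w` if `w` is
nonempty, and a blank cell otherwise. -/
def init (M : OneTapeDTM Q Γ) (w : List M.input) : Config Q Γ :=
  ⟨M.start, M.initTape w, 0⟩

/-- The accepted language: the inputs on which the computation reaches a halting configuration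
whose state is final. -/
def language (M : OneTapeDTM Q Γ) : Language M.input :=
  {w | ∃ c, Relation.ReflTransGen M.Yields (M.init w) c ∧ M.Halting c ∧ c.state ∈ M.final}

/-- The machine is weight-reducing: for some partial order on the working alphabet, each
rewriting is strictly decreasing. -/
def WeightReducing (M : OneTapeDTM Q Γ) : Prop :=
  ∃ ord : PartialOrder Γ, ∀ p σ q τ d, M.δ p σ = some (q, τ, d) → ord.lt τ σ

end OneTapeDTM

/-!
The proof uses crossing sequences. The crossing sequence of the boundary between two neighbouring
cells of the tape is the list of the states in which the head crosses it, in order of time; the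
directions of the crossings alternate, so they need not be recorded. `OneTapeDTM.Fits` says when a
symbol in a cell is consistent with the crossing sequences at its two boundaries.

Two facts carry the argument.

* An input is accepted if and only if crossing sequences can be assigned to all the boundaries, all
  but finitely many of them empty, so that every cell fits
  (`OneTapeDTM.mem_language_iff_exists_fits`).
  Both directions follow the computation step by step: a step of the machine deletes the first
  element of the crossing sequence at the boundary that is crossed. The total length of the crossing
  sequences decreases in each step, which is why the computation described by them halts.
* Each transition at a cell lowers the symbol in it, so the head leaves a cell fewer than `|Γ|` times
  and every crossing sequence that occurs has at most `2 |Γ|` elements (`OneTapeDTM.Fits.length_le`).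

A nondeterministic automaton therefore guesses the crossing sequences from left to right and checks
that each input cell fits. The blank parts of the tape on the two sides of the input are accounted
for by the transitions from the initial state and by the set of accepting states: which crossing
sequences can be completed there does not depend on the input. This gives at most
`1 + (|Q| + 1) ^ (2 |Γ|)` states, and the subset construction yields the deterministic automaton.
-/

namespace OneTapeDTM

variable {Q Γ : Type*}

/-! ### Crossing sequences and cells -/

/-- The position of the head as seen from a cell: to the left of the cell, on the cell in a given
state, or to the right of the cell. -/
inductive HeadPos (Q : Type*)
  | left
  | here (q : Q)
  | right

/-- `M.Fits p σ l r` says that a cell with symbol `σ`, seen by the head as `p`, can go through the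
rest of an accepting computation in which its left and right boundaries are crossed in the states
listed by `l` and `r`. If the computation halts on this cell, the state has to be final. -/
inductive Fits (M : OneTapeDTM Q Γ) : HeadPos Q → Γ → List Q → List Q → Prop
  | idle_left (σ : Γ) : Fits M .left σ [] []
  | idle_right (σ : Γ) : Fits M .right σ [] []
  | halt {q : Q} {σ : Γ} : M.δ q σ = none → q ∈ M.final → Fits M (.here q) σ [] []
  | enter_left {q : Q} {σ : Γ} {l r : List Q} : Fits M (.here q) σ l r → Fits M .left σ (q :: l) r
  | enter_right {q : Q} {σ : Γ} {l r : List Q} : Fits M (.here q) σ l r → Fits M .right σ l (q :: r)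
  | leave_left {q q' : Q} {σ τ : Γ} {l r : List Q} : M.δ q σ = some (q', τ, Turing.Dir.left) →
      Fits M .left τ l r → Fits M (.here q) σ (q' :: l) r
  | leave_right {q q' : Q} {σ τ : Γ} {l r : List Q} : M.δ q σ = some (q', τ, Turing.Dir.right) →
      Fits M .right τ l r → Fits M (.here q) σ l (q' :: r)

/-- The position of the head in the configuration `c`, as seen from cell `i`. -/
def Config.headPos (c : Config Q Γ) (i : ℤ) : HeadPos Q :=
  if c.head < i then .left else if c.head = i then .here c.state else .right

/-- The crossing sequences `r` describe an accepting computation from `c`, in the sense that every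
cell fits. Here `r i` belongs to the boundary between the cells `i - 1` and `i`. -/
def FitsAll (M : OneTapeDTM Q Γ) (c : Config Q Γ) (r : ℤ → List Q) : Prop :=
  ∀ i, M.Fits (c.headPos i) (c.tape i) (r i) (r (i + 1))

variable {M : OneTapeDTM Q Γ}

lemma Config.headPos_of_lt {c : Config Q Γ} {i : ℤ} (h : c.head < i) : c.headPos i = .left := by
  simp [headPos, h]

lemma Config.headPos_of_gt {c : Config Q Γ} {i : ℤ} (h : i < c.head) : c.headPos i = .right := by
  simp [headPos, h.not_gt, h.ne']

lemma Config.headPos_of_eq {c : Config Q Γ} {i : ℤ} (h : c.head = i) :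
    c.headPos i = .here c.state := by
  simp [headPos, h]

lemma halting_iff {c : Config Q Γ} : M.Halting c ↔ M.δ c.state (c.tape c.head) = none := by
  constructor
  · intro h
    rcases hd : M.δ c.state (c.tape c.head) with _ | ⟨q, τ, d⟩
    · rfl
    · exact absurd ⟨q, τ, d, hd, rfl⟩ (h _)
  · rintro h c' ⟨q, τ, d, hd, -⟩
    simp [h] at hd

lemma Fits.of_left_cons {σ : Γ} {q : Q} {l r : List Q} (h : M.Fits .left σ (q :: l) r) :
    M.Fits (.here q) σ l r := by
  cases h; assumption

lemma Fits.of_right_cons {σ : Γ} {q : Q} {l r : List Q} (h : M.Fits .right σ l (q :: r)) :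
    M.Fits (.here q) σ l r := by
  cases h; assumption

lemma Fits.of_here_left {σ τ : Γ} {p q : Q} {l r : List Q}
    (hδ : M.δ p σ = some (q, τ, Turing.Dir.left)) (h : M.Fits (.here p) σ (q :: l) r) :
    M.Fits .left τ l r := by
  cases h <;> simp_all

lemma Fits.of_here_right {σ τ : Γ} {p q : Q} {l r : List Q}
    (hδ : M.δ p σ = some (q, τ, Turing.Dir.right)) (h : M.Fits (.here p) σ l (q :: r)) :
    M.Fits .right τ l r := by
  cases h <;> simp_all

/-- The boundary crossed by a head that leaves cell `i` in the given direction. -/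
def crossed (i : ℤ) : Turing.Dir → ℤ
  | Turing.Dir.left => i
  | Turing.Dir.right => i + 1

/-- A step of the machine removes the first element of the crossing sequence at the boundary that
it crosses. -/
lemma fitsAll_step_iff {c : Config Q Γ} {q : Q} {τ : Γ} {d : Turing.Dir}
    (hδ : M.δ c.state (c.tape c.head) = some (q, τ, d)) {r r' : ℤ → List Q}
    (hr : r (crossed c.head d) = q :: r' (crossed c.head d))
    (hne : ∀ i, i ≠ crossed c.head d → r i = r' i) :
    M.FitsAll ⟨q, Function.update c.tape c.head τ, move c.head d⟩ r' ↔ M.FitsAll c r := by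
  obtain ⟨p, T, n⟩ := c
  cases d with
  | left =>
    simp only [crossed, move] at hδ hr hne ⊢
    have e1 : r (n + 1) = r' (n + 1) := hne _ (by omega)
    refine forall_congr' fun i => ?_
    dsimp only
    rcases lt_trichotomy i n with hi | rfl | hi
    · rw [Function.update_of_ne hi.ne, hne i hi.ne,
        Config.headPos_of_gt (c := ⟨p, T, n⟩) hi]
      rcases (Int.le_sub_one_of_lt hi).lt_or_eq with hi' | rfl
      · rw [Config.headPos_of_gt (by exact hi'), hne (i + 1) (by omega)]
      · rw [Config.headPos_of_eq (c := ⟨q, Function.update T n τ, n - 1⟩) rfl, sub_add_cancel, hr]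
        exact ⟨.enter_right, Fits.of_right_cons⟩
    · rw [Config.headPos_of_eq (c := ⟨p, T, i⟩) rfl, Config.headPos_of_lt (by simp), hr, Function.update_self, e1]
      exact ⟨.leave_left hδ, Fits.of_here_left hδ⟩
    · rw [Function.update_of_ne hi.ne', hne i hi.ne', hne (i + 1) (by omega),
        Config.headPos_of_lt (c := ⟨p, T, n⟩) hi, Config.headPos_of_lt (by simp; omega)]
  | right =>
    simp only [crossed, move] at hδ hr hne ⊢
    have e1 : r n = r' n := hne _ (by omega)
    refine forall_congr' fun i => ?_
    dsimp only
    rcases lt_trichotomy i n with hi | rfl | hi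
    · rw [Function.update_of_ne hi.ne, hne i (by omega), hne (i + 1) (by omega),
        Config.headPos_of_gt (c := ⟨p, T, n⟩) hi, Config.headPos_of_gt (by simp; omega)]
    · rw [Config.headPos_of_eq (c := ⟨p, T, i⟩) rfl, Config.headPos_of_gt (by simp), hr, Function.update_self, e1]
      exact ⟨.leave_right hδ, Fits.of_here_right hδ⟩
    · rw [Function.update_of_ne hi.ne', hne (i + 1) (by omega),
        Config.headPos_of_lt (c := ⟨p, T, n⟩) hi]
      rcases (Int.add_one_le_of_lt hi).lt_or_eq with hi' | rfl
      · rw [Config.headPos_of_lt (by exact hi'), hne i (by omega)]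
      · rw [Config.headPos_of_eq (c := ⟨q, Function.update T n τ, n + 1⟩) rfl, hr]
        exact ⟨.enter_left, Fits.of_left_cons⟩

/-! ### Accepting computations and crossing sequences -/

/-- Fitting crossing sequences with finite total length are realized by an accepting computation. -/
lemma exists_accepting_of_fitsAll (S : Finset ℤ) (n : ℕ) (c : Config Q Γ) (r : ℤ → List Q)
    (hS : ∀ i ∉ S, r i = []) (hn : ∑ i ∈ S, (r i).length = n) (h : M.FitsAll c r) :
    ∃ c', Relation.ReflTransGen M.Yields c c' ∧ M.Halting c' ∧ c'.state ∈ M.final := by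
  induction n using Nat.strong_induction_on generalizing c r with
  | _ n ih =>
    have step : ∀ q τ d, M.δ c.state (c.tape c.head) = some (q, τ, d) →
        ∀ l, r (crossed c.head d) = q :: l →
        ∃ c', Relation.ReflTransGen M.Yields c c' ∧ M.Halting c' ∧ c'.state ∈ M.final := by
      intro q τ d hδ l hl
      set b := crossed c.head d with hb
      have hbS : b ∈ S := by
        by_contra hbS
        simp [hS b hbS] at hl
      have hlt : ∑ i ∈ S, (Function.update r b l i).length < n := by
        rw [← hn]
        refine Finset.sum_lt_sum (fun i _ => ?_) ⟨b, hbS, by simp [hl]⟩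
        rcases eq_or_ne i b with rfl | hi
        · simp [hl]
        · simp [hi]
      obtain ⟨c', h1, h2⟩ := ih _ hlt _ (Function.update r b l)
        (fun i hi => by rw [Function.update_of_ne (by rintro rfl; exact hi hbS), hS i hi]) rfl
        ((fitsAll_step_iff hδ (by simp [← hb, hl])
          (fun i hi => by rw [Function.update_of_ne hi])).2 h)
      exact ⟨c', .head ⟨q, τ, d, hδ, rfl⟩ h1, h2⟩
    have h0 := h c.head
    rw [Config.headPos_of_eq rfl] at h0
    generalize hl : r c.head = l at h0
    generalize hr : r (c.head + 1) = t at h0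
    cases h0 with
    | halt h1 h2 => exact ⟨c, .refl, halting_iff.2 h1, h2⟩
    | leave_left h1 h2 => exact step _ _ _ h1 _ hl
    | leave_right h1 h2 => exact step _ _ _ h1 _ hr

/-- An accepting computation determines fitting crossing sequences, found backwards in time. -/
lemma exists_fitsAll_of_accepting {c c' : Config Q Γ} (h : Relation.ReflTransGen M.Yields c c')
    (hc : M.Halting c') (hf : c'.state ∈ M.final) :
    ∃ r : ℤ → List Q, {i | r i ≠ []}.Finite ∧ M.FitsAll c r := by
  induction h using Relation.ReflTransGen.head_induction_on with
  | refl =>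
    refine ⟨fun _ => [], by simp, fun i => ?_⟩
    rcases lt_trichotomy i c'.head with hi | rfl | hi
    · rw [Config.headPos_of_gt hi]; exact .idle_right _
    · rw [Config.headPos_of_eq rfl]; exact .halt (halting_iff.1 hc) hf
    · rw [Config.headPos_of_lt hi]; exact .idle_left _
  | @head a b hab _ ih =>
    obtain ⟨r', hfin, hr'⟩ := ih
    obtain ⟨q, τ, d, hδ, rfl⟩ := hab
    refine ⟨Function.update r' (crossed a.head d) (q :: r' (crossed a.head d)),
      (hfin.insert (crossed a.head d)).subset fun i hi => ?_,
      (fitsAll_step_iff hδ (by simp) fun i hi => by simp [hi]).1 hr'⟩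
    rcases eq_or_ne i (crossed a.head d) with rfl | hne
    · exact Set.mem_insert _ _
    · exact Set.mem_insert_of_mem _ (by simpa [hne] using hi)

lemma mem_language_iff_exists_fits (w : List M.input) :
    w ∈ M.language ↔ ∃ r : ℤ → List Q, {i | r i ≠ []}.Finite ∧ M.FitsAll (M.init w) r := by
  constructor
  · rintro ⟨c, h1, h2, h3⟩
    exact exists_fitsAll_of_accepting h1 h2 h3
  · rintro ⟨r, hfin, hr⟩
    exact exists_accepting_of_fitsAll hfin.toFinset _ _ r (fun i hi => by simpa using hi) rfl hr

/-! ### The two sides of the tape -/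

/-- The crossing sequence `l` can be continued through a half-infinite tape to the right that holds
`w` followed by blanks, if the head is initially to the left of it. -/
def RightFits (M : OneTapeDTM Q Γ) (w : List M.input) (l : List Q) : Prop :=
  ∃ s : ℕ → List Q, s 0 = l ∧ {n | s n ≠ []}.Finite ∧
    ∀ n : ℕ, M.Fits .left (M.initTape w n) (s n) (s (n + 1))

/-- The crossing sequence `l` can be continued through a blank half-infinite tape to the left, if
the head is initially to the right of it. -/
def LeftFits (M : OneTapeDTM Q Γ) (l : List Q) : Prop :=
  ∃ s : ℕ → List Q, s 0 = l ∧ {n | s n ≠ []}.Finite ∧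
    ∀ n : ℕ, M.Fits .right M.blank (s (n + 1)) (s n)

lemma initTape_cons_zero (a : M.input) (w : List M.input) : M.initTape (a :: w) 0 = a := by
  simp [initTape]

lemma initTape_cons_succ (a : M.input) (w : List M.input) (n : ℕ) :
    M.initTape (a :: w) ((n : ℤ) + 1) = M.initTape w n := by
  have h : ((n : ℤ) + 1).toNat = n + 1 := by omega
  have h' : (0 : ℤ) ≤ n + 1 := by omega
  simp [initTape, h, h']

lemma initTape_of_neg (w : List M.input) {i : ℤ} (hi : i < 0) : M.initTape w i = M.blank := by
  simp [initTape, hi.not_ge]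

lemma rightFits_cons_iff (a : M.input) (w : List M.input) (l : List Q) :
    M.RightFits (a :: w) l ↔ ∃ r, M.Fits .left a l r ∧ M.RightFits w r := by
  constructor
  · rintro ⟨s, rfl, hfin, hs⟩
    refine ⟨s 1, by simpa [initTape_cons_zero] using hs 0, fun n => s (n + 1), rfl,
      hfin.preimage (add_left_injective 1).injOn, fun n => ?_⟩
    simpa [initTape_cons_succ] using hs (n + 1)
  · rintro ⟨_, h0, s, rfl, hfin, hs⟩
    refine ⟨fun n => n.casesOn l s, rfl,
      ((hfin.image Nat.succ).insert 0).subset fun n hn => ?_, fun n => ?_⟩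
    · rcases n with _ | n
      · exact Set.mem_insert _ _
      · exact Set.mem_insert_of_mem _ ⟨n, hn, rfl⟩
    · rcases n with _ | n
      · simpa [initTape_cons_zero] using h0
      · simpa [initTape_cons_succ] using hs n

/-- The crossing sequences of the whole tape, cut at the first input cell. -/
lemma cons_mem_language_iff (a : M.input) (w : List M.input) :
    a :: w ∈ M.language ↔
      ∃ l r, M.LeftFits l ∧ M.Fits (.here M.start) a l r ∧ M.RightFits w r := by
  rw [mem_language_iff_exists_fits]
  constructor
  · rintro ⟨r, hfin, hr⟩
    refine ⟨r 0, r 1, ⟨fun n => r (-n), by simp,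
      hfin.preimage (neg_injective.comp Nat.cast_injective).injOn, fun n => ?_⟩, ?_,
      ⟨fun n => r (n + 1), by simp,
      hfin.preimage ((add_left_injective (1 : ℤ)).comp Nat.cast_injective).injOn, fun n => ?_⟩⟩
    · have := hr (-(n : ℤ) - 1)
      rw [Config.headPos_of_gt (by simp [init]; omega), sub_add_cancel] at this
      simp only [init] at this
      rw [initTape_of_neg _ (by omega)] at this
      simpa [sub_eq_add_neg, add_comm] using this
    · have := hr (M.init (a :: w)).head
      rw [Config.headPos_of_eq rfl] at this
      simpa [init, initTape_cons_zero] using this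
    · have := hr ((n : ℤ) + 1)
      rw [Config.headPos_of_lt (by simp only [init]; omega)] at this
      simpa [init, initTape_cons_succ] using this
  · rintro ⟨_, _, ⟨s, rfl, hsfin, hs⟩, h0, ⟨t, rfl, htfin, ht⟩⟩
    set r : ℤ → List Q := fun i => if i ≤ 0 then s (-i).toNat else t (i - 1).toNat with hrdef
    have hr1 : ∀ n : ℕ, r (-n) = s n := fun n => by simp [hrdef]
    have hr2 : ∀ n : ℕ, r (n + 1) = t n := fun n => by
      simp only [hrdef]
      rw [if_neg (by omega)]
      simp
    refine ⟨r, ((hsfin.image fun n : ℕ => (-n : ℤ)).union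
      (htfin.image fun n : ℕ => (n + 1 : ℤ))).subset fun i hi => ?_, fun i => ?_⟩
    · rcases le_or_gt i 0 with h | h
      · obtain ⟨n, rfl⟩ : ∃ n : ℕ, i = -n := ⟨(-i).toNat, by omega⟩
        exact Or.inl ⟨n, by simpa [hr1] using hi, rfl⟩
      · obtain ⟨n, rfl⟩ : ∃ n : ℕ, i = n + 1 := ⟨(i - 1).toNat, by omega⟩
        exact Or.inr ⟨n, by simpa [hr2] using hi, rfl⟩
    · rcases lt_trichotomy i 0 with h | rfl | h
      · obtain ⟨n, rfl⟩ : ∃ n : ℕ, i = -n - 1 := ⟨(-i - 1).toNat, by omega⟩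
        rw [Config.headPos_of_gt (by simpa [init] using h), sub_add_cancel, hr1,
          show -(n : ℤ) - 1 = -((n + 1 : ℕ) : ℤ) by push_cast; ring, hr1]
        simp only [init]
        rw [initTape_of_neg _ (by omega)]
        exact hs n
      · have e := (M.init (a :: w)).headPos_of_eq rfl
        have e0 : r 0 = s 0 := by simpa using hr1 0
        have e1 : r (0 + 1) = t 0 := by simpa using hr2 0
        rw [e0, e1]
        simp only [init] at e ⊢
        rw [e, initTape_cons_zero]
        exact h0
      · obtain ⟨n, rfl⟩ : ∃ n : ℕ, i = n + 1 := ⟨(i - 1).toNat, by omega⟩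
        rw [Config.headPos_of_lt (by exact h), hr2]
        simp only [init]
        rw [initTape_cons_succ, ← Nat.cast_succ, hr2]
        exact ht n

/-! ### The length of crossing sequences -/

/-- The rank of a symbol is the number of smaller symbols. -/
lemma WeightReducing.exists_rank [Fintype Γ] (hM : M.WeightReducing) :
    ∃ rank : Γ → ℕ, (∀ σ, rank σ < Fintype.card Γ) ∧
      ∀ p σ q τ d, M.δ p σ = some (q, τ, d) → rank τ < rank σ := by
  obtain ⟨ord, h⟩ := hM
  refine ⟨fun σ => (Set.Iio σ).ncard, fun σ => ?_, fun p σ q τ d hδ => ?_⟩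
  · rw [← Nat.card_eq_fintype_card, ← Set.ncard_univ]
    exact Set.ncard_lt_ncard
      ((Set.ssubset_univ_iff).2 fun e => lt_irrefl σ (e ▸ Set.mem_univ σ : σ ∈ Set.Iio σ))
      Set.finite_univ
  · exact Set.ncard_lt_ncard (Set.Iio_ssubset_Iio (h p σ q τ d hδ)) (Set.toFinite _)

/-- A visit to the cell that does not end the computation costs two crossings, one to enter and one
to leave, and lowers the rank of the symbol. -/
lemma Fits.length_add_length_le {rank : Γ → ℕ}
    (hrank : ∀ p σ q τ d, M.δ p σ = some (q, τ, d) → rank τ < rank σ)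
    {p : HeadPos Q} {σ : Γ} {l r : List Q} (h : M.Fits p σ l r) :
    l.length + r.length ≤ 2 * rank σ + (match p with | .here _ => 0 | _ => 1) := by
  induction h with
  | idle_left | idle_right | halt => simp
  | enter_left _ ih | enter_right _ ih => simp at ih ⊢; omega
  | leave_left hδ _ ih | leave_right hδ _ ih =>
    have := hrank _ _ _ _ _ hδ
    simp at ih ⊢
    omega

lemma Fits.length_le [Fintype Γ] (hM : M.WeightReducing)
    {p : HeadPos Q} {σ : Γ} {l r : List Q} (h : M.Fits p σ l r) :
    r.length ≤ 2 * Fintype.card Γ := by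
  obtain ⟨rank, hlt, hrank⟩ := hM.exists_rank
  have h1 := h.length_add_length_le hrank
  have h2 := hlt σ
  cases p <;> simp at h1 <;> omega

end OneTapeDTM

/-! ### Automata from residual languages -/

/-- Languages that satisfy the transition equations of a finite automaton are accepted by it. -/
lemma exists_nfa_of_residuals {α σ : Type*} [Finite σ] (R : σ → Language α) (step : σ → α → Set σ)
    (h : ∀ s a x, a :: x ∈ R s ↔ ∃ t ∈ step s a, x ∈ R t) (s₀ : σ) :
    ∃ N : NFA α (Fin (Nat.card σ)), (∃ s, N.start = {s}) ∧ N.accepts = R s₀ := by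
  let e := Finite.equivFin σ
  let N : NFA α (Fin (Nat.card σ)) :=
    ⟨fun i a => {j | e.symm j ∈ step (e.symm i) a}, {e s₀}, {i | [] ∈ R (e.symm i)}⟩
  have key : ∀ x S, x ∈ N.acceptsFrom S ↔ ∃ i ∈ S, x ∈ R (e.symm i) := by
    intro x
    induction x with
    | nil => intro S; simp [N]
    | cons a x ih =>
      intro S
      rw [NFA.cons_mem_acceptsFrom, ih]
      simp only [NFA.mem_stepSet, h]
      constructor
      · rintro ⟨j, ⟨i, hi, hij⟩, hx⟩
        exact ⟨i, hi, e.symm j, hij, hx⟩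
      · rintro ⟨i, hi, t, ht, hx⟩
        exact ⟨e t, ⟨i, hi, by simpa [N] using ht⟩, by simpa using hx⟩
  refine ⟨N, ⟨_, rfl⟩, ?_⟩
  ext x
  rw [NFA.accepts_eq_acceptsFrom_start, key]
  simp [N]

lemma exists_dfa_of_nfa {α : Type*} {k : ℕ} (N : NFA α (Fin k)) :
    ∃ D : DFA α (Fin (2 ^ k)), D.accepts = N.accepts :=
  ⟨DFA.reindex (Fintype.equivFinOfCardEq (by simp)) N.toDFA, by simp⟩

/-! ### Counting states -/

lemma natCard_lists_le (Q : Type*) [Fintype Q] (n : ℕ) :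
    Finite {l : List Q // l.length ≤ n} ∧
      Nat.card {l : List Q // l.length ≤ n} ≤ (Fintype.card Q + 1) ^ n := by
  let f : {l : List Q // l.length ≤ n} → (Fin n → Option Q) := fun l i => l.1[(i : ℕ)]?
  have hf : Function.Injective f := by
    rintro ⟨l, hl⟩ ⟨l', hl'⟩ h
    refine Subtype.ext (List.ext_getElem? fun i => ?_)
    by_cases hi : i < n
    · exact congrFun h ⟨i, hi⟩
    · simp only
      rw [List.getElem?_eq_none (by omega), List.getElem?_eq_none (by omega)]
  refine ⟨Finite.of_injective f hf, (Nat.card_le_card_of_injective f hf).trans ?_⟩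
  simp

lemma one_add_pow_le_two_rpow {q g : ℕ} (hq : 1 ≤ q) (hg : 1 ≤ g) :
    (((q + 1) ^ (2 * g) + 1 : ℕ) : ℝ) ≤ (2 : ℝ) ^ (5 * (g : ℝ) * max 1 (Real.logb 2 q)) := by
  set ℓ := max 1 (Real.logb 2 q)
  have hℓ : 1 ≤ ℓ := le_max_left _ _
  have hq0 : (0 : ℝ) < q := by exact_mod_cast hq
  have hg1 : (1 : ℝ) ≤ g := by exact_mod_cast hg
  have h1 : (q : ℝ) ≤ 2 ^ ℓ := by
    rw [← Real.logb_le_iff_le_rpow one_lt_two hq0]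
    exact le_max_right _ _
  have h2 : (2 : ℝ) ≤ 2 ^ ℓ := by
    simpa using Real.rpow_le_rpow_of_exponent_le one_le_two hℓ
  have h3 : (q : ℝ) + 1 ≤ 2 ^ (2 * ℓ) := by
    rw [two_mul, Real.rpow_add two_pos]
    nlinarith
  have h4 : ((q : ℝ) + 1) ^ (2 * g) ≤ 2 ^ (4 * g * ℓ) := by
    calc ((q : ℝ) + 1) ^ (2 * g) ≤ ((2 : ℝ) ^ (2 * ℓ)) ^ (2 * g) := by gcongr
      _ = 2 ^ (4 * g * ℓ) := by
        rw [← Real.rpow_natCast, ← Real.rpow_mul two_pos.le]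
        congr 1
        push_cast
        ring
  have h5 : (1 : ℝ) ≤ 2 ^ (4 * g * ℓ) := Real.one_le_rpow one_le_two (by positivity)
  have h6 : (2 : ℝ) ≤ 2 ^ (g * ℓ) := by
    simpa using Real.rpow_le_rpow_of_exponent_le one_le_two
      (show (1 : ℝ) ≤ g * ℓ by nlinarith)
  have h7 : (2 : ℝ) ^ (5 * (g : ℝ) * ℓ) = 2 ^ (4 * g * ℓ) * 2 ^ (g * ℓ) := by
    rw [← Real.rpow_add two_pos]
    congr 1
    ring
  rw [h7]
  push_cast
  nlinarith

/-! ### The automata of a weight-reducing machine -/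

namespace OneTapeDTM

/-- The initial state `none` has read nothing; `some l` is the guess that the boundary to the right
of the last letter read has the crossing sequence `l`. -/
lemma WeightReducing.exists_nfa {Q Γ : Type*} [Fintype Q] [Fintype Γ] {M : OneTapeDTM Q Γ}
    (hM : M.WeightReducing) :
    ∃ (k : ℕ) (N : NFA M.input (Fin k)), (∃ s, N.start = {s}) ∧ N.accepts = M.language ∧
      k ≤ (Fintype.card Q + 1) ^ (2 * Fintype.card Γ) + 1 := by
  obtain ⟨hfin, hcard⟩ := natCard_lists_le Q (2 * Fintype.card Γ)
  let σ := {l : List Q // l.length ≤ 2 * Fintype.card Γ}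
  let R : Option σ → Language M.input := fun s =>
    s.elim M.language fun l => {w | M.RightFits w l.1}
  let step : Option σ → M.input → Set (Option σ) := fun s a => s.elim
    {t | ∃ l, ∃ r : σ, t = some r ∧ M.LeftFits l ∧ M.Fits (.here M.start) a l r.1}
    fun l => {t | ∃ r : σ, t = some r ∧ M.Fits .left a l.1 r.1}
  have hR : ∀ s a x, a :: x ∈ R s ↔ ∃ t ∈ step s a, x ∈ R t := by
    intro s a x
    cases s with
    | none =>
      refine (cons_mem_language_iff a x).trans ⟨?_, ?_⟩
      · rintro ⟨l, r, h1, h2, h3⟩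
        exact ⟨some ⟨r, h2.length_le hM⟩, ⟨l, _, rfl, h1, h2⟩, h3⟩
      · rintro ⟨_, ⟨l, r, rfl, h1, h2⟩, h3⟩
        exact ⟨l, r, h1, h2, h3⟩
    | some l =>
      refine (rightFits_cons_iff a x l.1).trans ⟨?_, ?_⟩
      · rintro ⟨r, h1, h2⟩
        exact ⟨some ⟨r, h1.length_le hM⟩, ⟨_, rfl, h1⟩, h2⟩
      · rintro ⟨_, ⟨r, rfl, h1⟩, h2⟩
        exact ⟨r, h1, h2⟩
  obtain ⟨N, h1, h2⟩ := exists_nfa_of_residuals R step hR none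
  refine ⟨_, N, h1, h2, ?_⟩
  rw [Finite.card_option]
  exact Nat.succ_le_succ hcard

end OneTapeDTM

theorem mainTheorem1 :
    ∃ C : ℝ, 0 < C ∧
      ∀ (Q Γ : Type*) [Fintype Q] [Fintype Γ] (M : OneTapeDTM Q Γ), M.WeightReducing →
        (∃ (k : ℕ) (N : NFA M.input (Fin k)),
          (∃ s, N.start = {s}) ∧ N.accepts = M.language ∧
          (k : ℝ) ≤ (2 : ℝ) ^
            (C * (Fintype.card Γ : ℝ) * max 1 (Real.logb 2 (Fintype.card Q : ℝ)))) ∧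
        (∃ (k : ℕ) (D : DFA M.input (Fin k)),
          D.accepts = M.language ∧
          (k : ℝ) ≤ (2 : ℝ) ^ ((2 : ℝ) ^
            (C * (Fintype.card Γ : ℝ) * max 1 (Real.logb 2 (Fintype.card Q : ℝ))))) := by
  refine ⟨5, by norm_num, fun Q Γ _ _ M hM => ?_⟩
  obtain ⟨k, N, hs, hN, hk⟩ := hM.exists_nfa
  have hbound := (Nat.cast_le (α := ℝ).2 hk).trans (one_add_pow_le_two_rpow
    (Fintype.card_pos_iff.2 ⟨M.start⟩) (Fintype.card_pos_iff.2 ⟨M.blank⟩))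
  obtain ⟨D, hD⟩ := exists_dfa_of_nfa N
  refine ⟨⟨k, N, hs, hN, hbound⟩, 2 ^ k, D, hD.trans hN, ?_⟩
  rw [Nat.cast_pow, Nat.cast_ofNat, ← Real.rpow_natCast]
  exact Real.rpow_le_rpow_of_exponent_le one_le_two hbound
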